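/- Let $k$ be an infinite field, let $S=k[x_0,\dots,x_n]$ be the standard graded polynomial ring, let $\mathfrak p\subset S$ be a homogeneous prime ideal, and let $R=S/\mathfrak p$, with homogeneous maximal ideal $\mathfrak m=(x_0,\dots,x_n)R$ and Krull dimension $r=\dim R$. Let $d\ge 1$ be an integer, let $M_1,\dots,M_N$ be the monomials of degree $d$ in $S$, where $N=\binom{n+d}{d}$, and for $\mathbf a=(a_1,\dots,a_N)\in k^N$ put $f_{\mathbf a}=\sum_{i=1}^N a_iM_i$. For an ideal $I\subseteq R$ let $\ell_R(I)$ denote its analytic spread, i.e. the Krull dimension of the special fiber $R[It]/\mathfrak m R[It]$, where $R[It]\subseteq R[t]$ is the Rees algebra of $I$. Let $\mathbb P^{(n+1)N-1}$ be the set of lines in $k^{(n+1)N}$ through the origin, equipped with the Zariski topology, whose closed sets are the common zero sets of sets of homogeneous polynomials over $k$. Then the Noether normalization locus $$\mathcal N_{n+1}=\{(\mathbf a_0,\dots,\mathbf a_n)\in\mathbb P^{(n+1)N-1} : \ell_R\big((f_{\mathbf a_0},\dots,f_{\mathbf a_n})R\big)=r\}$$ is a non-empty Zariski-open subset of $\mathbb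 P^{(n+1)N-1}$. Moreover, it consists exactly of the points for which $(f_{\mathbf a_0},\dots,f_{\mathbf a_n})R$ has maximum analytic spread, i.e. for which $\ell_R\big((f_{\mathbf a_0},\dots,f_{\mathbf a_n})R\big)=\min\{\dim R,\,n+1\}$. -/

import Mathlib

open MvPolynomial

attribute [local instance] MvPolynomial.gradedAlgebra

/-- The exponents of the monomials of degree `d` in the variables `x_0, …, x_n`. -/
abbrev MonomialExponent (n d : ℕ) : Type :=
  ↥((Finset.univ : Finset (Fin (n + 1))).finsuppAntidiag d)

theorem card_monomialExponent (n d : ℕ) :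
    Fintype.card (MonomialExponent n d) = (n + d).choose d := by
  rw [Fintype.card_coe, Finset.card_finsuppAntidiag_nat_eq_choose]
  congr 1
  simp only [Finset.card_univ, Fintype.card_fin]
  omega

/-- Exponents are exactly the multi-indices of total degree `d`. -/
theorem mem_monomialExponent (n d : ℕ) (e : Fin (n + 1) →₀ ℕ) :
    e ∈ (Finset.univ : Finset (Fin (n + 1))).finsuppAntidiag d ↔ e.degree = d := by
  simp [Finset.mem_finsuppAntidiag, Finsupp.degree_eq_sum]

section Forms

variable {k : Type*} [Field k] {n d m : ℕ}

/-- The form `f_a = ∑ a_e x^e` of degree `d` with coefficient vector `a`. -/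
noncomputable def formOfCoeffs (a : MonomialExponent n d → k) : MvPolynomial (Fin (n + 1)) k :=
  ∑ e, monomial e.1 (a e)

/-- The classes in `R = k[x_0, …, x_n] / p` of the `m` forms whose coefficients are listed in
`v = (a_0, …, a_{m-1})`. -/
noncomputable def formClasses (p : Ideal (MvPolynomial (Fin (n + 1)) k))
    (v : Fin m × MonomialExponent n d → k) (i : Fin m) : MvPolynomial (Fin (n + 1)) k ⧸ p :=
  Ideal.Quotient.mk p (formOfCoeffs fun e => v (i, e))

/-- The ideal `(f_{a_0}, …, f_{a_{m-1}})` of `R = k[x_0, …, x_n] / p`. -/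
noncomputable def formIdeal (p : Ideal (MvPolynomial (Fin (n + 1)) k))
    (v : Fin m × MonomialExponent n d → k) : Ideal (MvPolynomial (Fin (n + 1)) k ⧸ p) :=
  Ideal.span (Set.range (formClasses p v))

/-- The homogeneous maximal ideal `(x_0, …, x_n) R` of `R = k[x_0, …, x_n] / p`. -/
noncomputable def irrelevantIdeal (p : Ideal (MvPolynomial (Fin (n + 1)) k)) :
    Ideal (MvPolynomial (Fin (n + 1)) k ⧸ p) :=
  Ideal.span (Set.range fun i : Fin (n + 1) => Ideal.Quotient.mk p (X i))

end Forms

section AnalyticSpread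

variable {A : Type*} [CommRing A]

/-- The special fiber `A[It] / 𝔪 A[It]` of the ideal `I` with respect to `𝔪`, a quotient of the
Rees algebra `A[It] ⊆ A[t]`. -/
abbrev SpecialFiber (𝔪 I : Ideal A) : Type _ :=
  reesAlgebra I ⧸ 𝔪.map (algebraMap A (reesAlgebra I))

/-- The analytic spread of `I` with respect to `𝔪`: the Krull dimension of the special fiber. -/
noncomputable def analyticSpread (𝔪 I : Ideal A) : WithBot ℕ∞ :=
  ringKrullDim (SpecialFiber 𝔪 I)

/-- The ideal generated by `g_0, …, g_{s-1}` has maximum analytic spread: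
its analytic spread is `min (dim A) s`. -/
def HasMaximumAnalyticSpread (𝔪 : Ideal A) {s : ℕ} (g : Fin s → A) : Prop :=
  analyticSpread 𝔪 (Ideal.span (Set.range g)) = min (ringKrullDim A) (s : WithBot ℕ∞)

end AnalyticSpread

section Zariski

variable {k : Type*} [Field k] {σ : Type*}

/-- A set of points of the projective space of `σ → k` is Zariski closed if it is the common zero
set of a set of homogeneous polynomials over `k`. -/
def IsZariskiClosed (Z : Set (Projectivization k (σ → k))) : Prop :=
  ∃ P : Set (MvPolynomial σ k), (∀ F ∈ P, ∃ e : ℕ, F.IsHomogeneous e) ∧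
    ∀ (v : σ → k) (hv : v ≠ 0), Projectivization.mk k v hv ∈ Z ↔ ∀ F ∈ P, eval v F = 0

/-- A set of points of projective space is Zariski open if its complement is Zariski closed. -/
def IsZariskiOpen (U : Set (Projectivization k (σ → k))) : Prop :=
  IsZariskiClosed Uᶜ

end Zariski

section Locus

variable {k : Type*} [Field k] {n : ℕ}

/-- The locus of the points `(a_0, …, a_{m-1})` of the projective space of `k^{mN}` for which
the ideal `(f_{a_0}, …, f_{a_{m-1}})` of `R = k[x_0, …, x_n] / p` has analytic spread `dim R`. -/
def noetherNormalizationLocus (p : Ideal (MvPolynomial (Fin (n + 1)) k)) (d m : ℕ) :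
    Set (Projectivization k (Fin m × MonomialExponent n d → k)) :=
  {x | analyticSpread (irrelevantIdeal p) (formIdeal p x.rep)
      = ringKrullDim (MvPolynomial (Fin (n + 1)) k ⧸ p)}

/-- The ideal of a point does not depend on the homogeneous coordinates. -/
theorem formIdeal_smul {d m : ℕ} (p : Ideal (MvPolynomial (Fin (n + 1)) k)) (c : kˣ)
    (v : Fin m × MonomialExponent n d → k) : formIdeal p (c • v) = formIdeal p v := by
  have key : ∀ (c : kˣ) (v : Fin m × MonomialExponent n d → k),
      formIdeal p (c • v) ≤ formIdeal p v := by
    intro c v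
    refine Ideal.span_le.2 ?_
    rintro _ ⟨i, rfl⟩
    have h : formClasses p (c • v) i = Ideal.Quotient.mk p (C (c : k)) * formClasses p v i := by
      simp only [formClasses, ← map_mul, formOfCoeffs, Finset.mul_sum, C_mul_monomial]
      rfl
    rw [h]
    exact Ideal.mul_mem_left _ _ (Ideal.subset_span ⟨i, rfl⟩)
  refine le_antisymm (key c v) ?_
  simpa using key c⁻¹ (c • v)

theorem mk_mem_noetherNormalizationLocus {d m : ℕ} (p : Ideal (MvPolynomial (Fin (n + 1)) k))
    (v : Fin m × MonomialExponent n d → k) (hv : v ≠ 0) :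
    Projectivization.mk k v hv ∈ noetherNormalizationLocus p d m ↔
      analyticSpread (irrelevantIdeal p) (formIdeal p v)
        = ringKrullDim (MvPolynomial (Fin (n + 1)) k ⧸ p) := by
  obtain ⟨c, hc⟩ := Projectivization.exists_smul_eq_mk_rep k v hv
  rw [noetherNormalizationLocus, Set.mem_ofPred_eq, ← hc, formIdeal_smul]

end Locus

/-! ### Krull dimension and transcendence degree -/

section Dimension

/-! Forms `f_i` of one degree `d ≥ 1` in the graded domain `R` have special fiber isomorphic to the
subalgebra `k[f]` of `R` (`analyticSpread_span_eq_ringKrullDim_adjoin`). Its dimension is its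
transcendence degree, so a point lies in the locus exactly when `R` is algebraic over `k[f]`
(`ringKrullDim_adjoin_eq_iff_isAlgebraic`). This holds for `f_i = x_i ^ d`, hence non-emptiness. The
last claim follows from `dim R ≤ n + 1`.

For openness, algebraicity is rewritten as the existence of enough linearly independent monomials in
the `f_i` (`isAlgebraic_iff_exists_linearIndependent_monomials`). Let `V` be spanned by `1` and the
`x_i`, and let `s = dim R`, so `dim V ^ D ≤ C (D + 1) ^ s`. If some `x_i` is transcendental over
`k[f]`, then `m` independent monomials of degree at most `J` in `f`, times `1, x_i, …, x_i ^ J`,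
give `m (J + 1)` independent elements of `V ^ (d J + J)`. So `m (J + 1) > C (d J + J + 1) ^ s`
forces algebraicity. Conversely, a transcendence basis among the `f_i` provides enough monomials to
reach this inequality.

The numbers `C` and `s` do not depend on the `f_i`. Independence of given monomials means that some
determinant of values of linear forms is nonzero, and such a determinant is a homogeneous polynomial
in the coefficients of the `f_i`. The complement of the locus is the common zero set of these
determinants. -/

/-- Incomparability makes contraction of primes strictly monotone; lying over and going up lift
chains. -/
theorem ringKrullDim_eq_of_isIntegral_of_injective {A B : Type*} [CommRing A] [CommRing B]
    [Algebra A B] [Algebra.IsIntegral A B] (hinj : Function.Injective (algebraMap A B)) :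
    ringKrullDim B = ringKrullDim A := by
  have : FaithfulSMul A B := (faithfulSMul_iff_algebraMap_injective A B).mpr hinj
  refine le_antisymm ?_ ?_
  · refine Order.krullDim_le_of_strictMono (PrimeSpectrum.comap (algebraMap A B)) ?_
    intro P Q hPQ
    exact Ideal.IsIntegral.comap_lt_comap (I := P.asIdeal) (J := Q.asIdeal) hPQ
  · refine iSup_le fun l => ?_
    obtain ⟨P, hP⟩ := Algebra.IsIntegral.comap_surjective A B l.head
    have : P.asIdeal.LiesOver (RelSeries.head l).asIdeal := ⟨by rw [← hP]; rfl⟩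
    obtain ⟨L, hL, -⟩ := Ideal.exists_ltSeries_of_hasGoingUp l P.asIdeal
    rw [← hL]
    exact Order.LTSeries.length_le_krullDim L

variable (k R : Type*) [Field k] [CommRing R] [IsDomain R] [Algebra k R] [Algebra.FiniteType k R]

/-- One Noether normalization computes both invariants. -/
theorem exists_finite_mvPolynomial_ringKrullDim_eq :
    ∃ (s : ℕ) (g : MvPolynomial (Fin s) k →ₐ[k] R), Function.Injective g ∧ g.Finite ∧
      ringKrullDim R = s ∧ Algebra.trdeg k R = s := by
  obtain ⟨s, g, hg, hfin⟩ := exists_finite_inj_algHom_of_fg k R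
  refine ⟨s, g, hg, hfin, ?_, ?_⟩
  · algebraize [g.toRingHom]
    have : Algebra.IsIntegral (MvPolynomial (Fin s) k) R := ⟨hfin.to_isIntegral⟩
    rw [ringKrullDim_eq_of_isIntegral_of_injective (A := MvPolynomial (Fin s) k) hg]
    simp
  · let _ := g.toRingHom.toAlgebra
    have : IsScalarTower k (MvPolynomial (Fin s) k) R := .of_algebraMap_eq fun x => (g.commutes x).symm
    have : Algebra.IsIntegral (MvPolynomial (Fin s) k) R := ⟨hfin.to_isIntegral⟩
    have : FaithfulSMul (MvPolynomial (Fin s) k) R :=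
      (faithfulSMul_iff_algebraMap_injective _ _).mpr hg
    have h := lift_trdeg_add_eq k (MvPolynomial (Fin s) k) R
    rw [trdeg_eq_zero (R := MvPolynomial (Fin s) k) (A := R),
      MvPolynomial.trdeg_of_isDomain] at h
    rw [← Cardinal.lift_inj, ← h]
    simp

theorem ringKrullDim_eq_natCast_iff_trdeg (s : ℕ) :
    ringKrullDim R = s ↔ Algebra.trdeg k R = s := by
  obtain ⟨t, -, -, -, h1, h2⟩ := exists_finite_mvPolynomial_ringKrullDim_eq k R
  rw [h1, h2]
  norm_cast

end Dimension

/-! ### Polynomial growth of the powers of a finite-dimensional subspace -/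

section Growth

variable {k : Type*} [Field k]

theorem finrank_restrictDegree_le (s E : ℕ) :
    Module.Finite k (restrictDegree (Fin s) k E) ∧
      Module.finrank k (restrictDegree (Fin s) k E) ≤ (E + 1) ^ s := by
  let S : Set (Fin s →₀ ℕ) := {n | ∀ i, n i ≤ E}
  let F : S → (Fin s → Fin (E + 1)) := fun a i => ⟨a.1 i, Nat.lt_succ_of_le (a.2 i)⟩
  have hF : Function.Injective F := by
    intro a b hab
    ext i
    simpa [F] using congrFun hab i
  have : Finite S := .of_injective F hF
  have b : Module.Basis S k (restrictDegree (Fin s) k E) := basisRestrictSupport k S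
  refine ⟨.of_basis b, ?_⟩
  rw [Module.finrank_eq_nat_card_basis b]
  simpa using Nat.card_le_card_of_injective F hF

variable {R : Type*} [CommRing R] [Algebra k R]

/-- Filter `R` by the degrees of coefficients with respect to module generators `e l` over the
polynomial ring. Multiplication by a fixed element raises the filtration degree by a bounded amount,
so `V ^ D` sits in a step of degree linear in `D`. -/
theorem exists_finrank_pow_le {s : ℕ} (g : MvPolynomial (Fin s) k →ₐ[k] R) (hg : g.Finite)
    {V : Submodule k R} (hV : V.FG) :
    ∃ C : ℕ, ∀ D : ℕ, Module.finrank k ↥(V ^ D) ≤ C * (D + 1) ^ s := by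
  let _ := g.toRingHom.toAlgebra
  have hfin : Module.Finite (MvPolynomial (Fin s) k) R := hg
  have hsmul : ∀ (c : MvPolynomial (Fin s) k) (r : R), c • r = g c * r := fun c r => rfl
  obtain ⟨m, e, he⟩ := Module.Finite.exists_fin (R := MvPolynomial (Fin s) k) (M := R)
  have hrep : ∀ r : R, ∃ c : Fin m → MvPolynomial (Fin s) k, ∑ l, g (c l) * e l = r := by
    intro r
    have : r ∈ Submodule.span (MvPolynomial (Fin s) k) (Set.range e) := he ▸ Submodule.mem_top
    obtain ⟨c, hc⟩ := (Submodule.mem_span_range_iff_exists_fun _).1 this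
    exact ⟨c, hc⟩
  let L : (Fin m → MvPolynomial (Fin s) k) →ₗ[k] R :=
    ∑ l, (LinearMap.mulRight k (e l)) ∘ₗ g.toLinearMap ∘ₗ LinearMap.proj l
  have hL : ∀ c, L c = ∑ l, g (c l) * e l := fun c => by simp [L, LinearMap.sum_apply]
  let U : ℕ → Submodule k R := fun E =>
    (Submodule.pi Set.univ fun _ : Fin m => restrictTotalDegree (Fin s) k E).map L
  have hU : ∀ E r, r ∈ U E ↔ ∃ c : Fin m → MvPolynomial (Fin s) k,
      (∀ l, (c l).totalDegree ≤ E) ∧ ∑ l, g (c l) * e l = r := by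
    intro E r
    simp only [U, Submodule.mem_map, Submodule.mem_pi, Set.mem_univ, true_imp_iff,
      mem_restrictTotalDegree, hL]
  have hUmono : ∀ {E E'}, E ≤ E' → U E ≤ U E' := by
    intro E E' h r hr
    rw [hU] at hr ⊢
    obtain ⟨c, hc, hr⟩ := hr
    exact ⟨c, fun l => (hc l).trans h, hr⟩
  have hone : ∃ N, (1 : R) ∈ U N := by
    obtain ⟨c, hc⟩ := hrep 1
    exact ⟨Finset.univ.sup fun l => (c l).totalDegree,
      (hU _ _).2 ⟨c, fun l => Finset.le_sup (f := fun l => (c l).totalDegree) (Finset.mem_univ l), hc⟩⟩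
  have hmul : ∀ v : R, ∃ N, ∀ E, ∀ u ∈ U E, v * u ∈ U (N + E) := by
    intro v
    -- The matrix of multiplication by `v` on the generators; the largest degree of its entries is
    -- the shift.
    choose c hc using fun l => hrep (v * e l)
    refine ⟨Finset.univ.sup fun l => Finset.univ.sup fun j => (c l j).totalDegree, fun E u hu => ?_⟩
    obtain ⟨q, hq, rfl⟩ := (hU _ _).1 hu
    refine (hU _ _).2 ⟨fun j => ∑ l, c l j * q l, fun j => ?_, ?_⟩
    · refine totalDegree_finsetSum_le fun l _ => (totalDegree_mul _ _).trans ?_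
      refine add_le_add ?_ (hq l)
      exact (Finset.le_sup (f := fun j => (c l j).totalDegree) (Finset.mem_univ j)).trans
        (Finset.le_sup (f := fun l => Finset.univ.sup fun j => (c l j).totalDegree)
          (Finset.mem_univ l))
    · simp only [map_sum, map_mul, Finset.sum_mul, Finset.mul_sum]
      rw [Finset.sum_comm]
      refine Finset.sum_congr rfl fun l _ => ?_
      rw [show v * (g (q l) * e l) = g (q l) * (v * e l) by ring, ← hc l, Finset.mul_sum]
      exact Finset.sum_congr rfl fun j _ => by ring
  obtain ⟨t, rfl⟩ := hV
  choose N hN using hmul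
  obtain ⟨N₀, hN₀⟩ := hone
  set M := t.sup N with hM
  have hpow : ∀ D, (Submodule.span k (t : Set R)) ^ D ≤ U (N₀ + D * M) := by
    intro D
    induction D with
    | zero =>
      rw [pow_zero, Submodule.one_le]
      exact hUmono (by omega) hN₀
    | succ D ih =>
      rw [pow_succ', Submodule.mul_le]
      intro v hv u hu
      have hu' := ih hu
      refine Submodule.span_induction (p := fun v _ => v * u ∈ U (N₀ + (D + 1) * M)) ?_ ?_ ?_ ?_ hv
      · intro v hv
        refine hUmono ?_ (hN v _ u hu')
        have := Finset.le_sup (f := N) (show v ∈ t from hv)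
        rw [← hM] at this
        linarith
      · simp
      · intro x y _ _ hx hy
        rw [add_mul x y u]
        exact add_mem hx hy
      · intro a x _ hx
        rw [smul_mul_assoc]
        exact Submodule.smul_mem _ _ hx
  -- The constant comes from `N₀ + D * M + 1 ≤ (N₀ + M + 1) * (D + 1)`.
  refine ⟨m * (N₀ + M + 1) ^ s, fun D => ?_⟩
  set E := N₀ + D * M
  let L' : (Fin m → restrictDegree (Fin s) k E) →ₗ[k] R :=
    L ∘ₗ LinearMap.pi fun l => (restrictDegree (Fin s) k E).subtype ∘ₗ LinearMap.proj l
  have hle : U E ≤ LinearMap.range L' := by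
    intro r hr
    obtain ⟨c, hc, hr⟩ := (hU _ _).1 hr
    refine ⟨fun l => ⟨c l, restrictTotalDegree_le_restrictDegree (σ := Fin s) (R := k) (m := E)
      ((mem_restrictTotalDegree _ _ _).2 (hc l))⟩, ?_⟩
    rw [← hr, ← hL]
    rfl
  obtain ⟨hfd, hbd⟩ := finrank_restrictDegree_le (k := k) s E
  calc Module.finrank k ↥((Submodule.span k (t : Set R)) ^ D)
      ≤ Module.finrank k (LinearMap.range L') :=
        Submodule.finrank_mono ((hpow D).trans hle)
    _ ≤ Module.finrank k (Fin m → restrictDegree (Fin s) k E) := LinearMap.finrank_range_le _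
    _ = m * Module.finrank k (restrictDegree (Fin s) k E) := by
        rw [Module.finrank_pi_fintype]; simp
    _ ≤ m * (E + 1) ^ s := by gcongr
    _ ≤ m * ((N₀ + M + 1) * (D + 1)) ^ s := by
        gcongr
        simp only [E]
        nlinarith [Nat.zero_le (N₀ * D), Nat.zero_le M]
    _ = m * (N₀ + M + 1) ^ s * (D + 1) ^ s := by rw [mul_pow]; ring

end Growth

/-! ### Algebraicity detected by counting independent monomials -/

section Criterion

variable {k : Type*} [Field k] {R : Type*} [CommRing R] [IsDomain R] [Algebra k R]
  {ι : Type*}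

theorem linearIndependent_pow_of_transcendental {A B : Type*} [CommRing A] [CommRing B]
    [Algebra A B] {x : B} (hx : Transcendental A x) (J : ℕ) :
    LinearIndependent A fun b : Fin J => x ^ (b : ℕ) := by
  have h1 : LinearIndependent A fun b : ℕ => (Polynomial.X ^ b : Polynomial A) := by
    simpa [Polynomial.coe_basisMonomials, ← Polynomial.X_pow_eq_monomial] using
      (Polynomial.basisMonomials A).linearIndependent
  have h2 := (h1.map' (Polynomial.aeval x).toLinearMap
    (LinearMap.ker_eq_bot.2 (transcendental_iff_injective.1 hx))).comp
      (fun b : Fin J => (b : ℕ)) Fin.val_injective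
  simpa [Function.comp_def] using h2

theorem prod_pow_mem_pow {A κ : Type*} [CommRing A] [Algebra k A] {V : Submodule k A} {d : ℕ}
    {f : κ → A} (hf : ∀ i, f i ∈ V ^ d) (c : κ → ℕ) (t : Finset κ) :
    ∏ j ∈ t, f j ^ c j ∈ V ^ ∑ j ∈ t, d * c j := by
  classical
  induction t using Finset.induction_on with
  | empty => simpa using (Submodule.one_le (P := (1 : Submodule k A))).1 le_rfl
  | insert a t ha ih =>
    rw [Finset.prod_insert ha, Finset.sum_insert ha, pow_add, pow_mul]
    exact Submodule.mul_mem_mul (Submodule.pow_mem_pow _ (hf a) _) ih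

/-- The family `f` contains a transcendence basis, which has `s` elements; take its monomials with
every exponent at most `q`. -/
theorem exists_linearIndependent_monomials {s : ℕ} {f : ι → R}
    (halg : Algebra.IsAlgebraic (Algebra.adjoin k (Set.range f)) R)
    (hs : Algebra.trdeg k R = s) (q : ℕ) :
    ∃ α : Fin ((q + 1) ^ s) → ι →₀ ℕ, (∀ i, (α i).degree ≤ s * q) ∧
      LinearIndependent k fun i => (α i).prod fun j e => f j ^ e := by
  classical
  obtain ⟨t, htf, ht⟩ := exists_isTranscendenceBasis_subset (R := k) (A := R) (Set.range f)
  have hcard : Cardinal.mk t = s := ht.cardinalMk_eq_trdeg.trans hs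
  have hfin : Finite t := Cardinal.mk_lt_aleph0_iff.1 (hcard ▸ Cardinal.natCast_lt_aleph0)
  have := Fintype.ofFinite t
  have hcard' : Fintype.card t = s := by
    rw [Cardinal.mk_fintype] at hcard
    exact_mod_cast hcard
  choose a ha using fun y : t => htf y.2
  let α : (t → Fin (q + 1)) → ι →₀ ℕ := fun β => ∑ y, Finsupp.single (a y) (β y : ℕ)
  have hα : ∀ β, (α β).degree ≤ s * q := by
    intro β
    simp only [α, map_sum, Finsupp.degree_single]
    calc ∑ y, (β y : ℕ) ≤ ∑ _y : t, q := Finset.sum_le_sum fun y _ => Nat.lt_succ_iff.1 (β y).2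
      _ = s * q := by simp [hcard']
  have hprod : ∀ β, ((α β).prod fun j e => f j ^ e) = ∏ y : t, (y : R) ^ (β y : ℕ) := by
    intro β
    have h : ∀ c : ι →₀ ℕ, (c.prod fun j e => f j ^ e) = aeval f (monomial c (1 : k)) := by
      intro c
      rw [aeval_monomial, map_one, one_mul]
    rw [h, ← h]
    simp only [α]
    rw [← Finsupp.prod_finsetSum_index (by simp) (by intros; rw [pow_add])]
    simp [ha]
  have hli : LinearIndependent k fun β : t → Fin (q + 1) => ∏ y : t, (y : R) ^ (β y : ℕ) := by
    have h1 := ((basisMonomials t k).linearIndependent.map' (aeval ((↑) : t → R)).toLinearMap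
      (LinearMap.ker_eq_bot.2 ht.1)).comp
        (fun β : t → Fin (q + 1) => Finsupp.equivFunOnFinite.symm fun y => (β y : ℕ)) (by
          intro β γ h
          ext y
          simpa using congrFun (Finsupp.equivFunOnFinite.symm.injective h) y)
    simpa [Function.comp_def, aeval_monomial, Finsupp.prod_fintype] using h1
  have e : Fin ((q + 1) ^ s) ≃ (t → Fin (q + 1)) :=
    (Fintype.equivFinOfCardEq (by simp [hcard'])).symm
  refine ⟨α ∘ e, fun i => hα _, ?_⟩
  convert hli.comp e e.injective using 1
  ext i
  exact hprod _

theorem isAlgebraic_of_forall_generator {κ : Type*} {x : κ → R}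
    (hx : Algebra.adjoin k (Set.range x) = ⊤) {B : Subalgebra k R}
    (hall : ∀ i, IsAlgebraic B (x i)) : Algebra.IsAlgebraic B R := by
  have h1 : (Algebra.adjoin B (Set.range x)).IsAlgebraic := by
    rw [Algebra.isAlgebraic_adjoin_iff]
    rintro _ ⟨i, rfl⟩
    exact hall i
  have h2 : Algebra.adjoin B (Set.range x) = ⊤ := by
    rw [eq_top_iff]
    intro y _
    have hy : y ∈ Algebra.adjoin k (Set.range x) := hx ▸ Algebra.mem_top
    have hle : Algebra.adjoin k (Set.range x) ≤ (Algebra.adjoin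
        B (Set.range x)).restrictScalars k :=
      Algebra.adjoin_le Algebra.subset_adjoin
    exact hle hy
  rw [h2] at h1
  exact ⟨fun y => h1 y Algebra.mem_top⟩

theorem isAlgebraic_iff_exists_linearIndependent_monomials {N : ℕ} {x : Fin N → R}
    (hx : Algebra.adjoin k (Set.range x) = ⊤) {f : ι → R} {d : ℕ}
    (hf : ∀ i, f i ∈ Submodule.span k (insert 1 (Set.range x)) ^ d) {s C : ℕ}
    (hs : Algebra.trdeg k R = s)
    (hC : ∀ D : ℕ, Module.finrank k ↥(Submodule.span k (insert 1 (Set.range x)) ^ D)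
      ≤ C * (D + 1) ^ s) :
    Algebra.IsAlgebraic (Algebra.adjoin k (Set.range f)) R ↔
      ∃ (J m : ℕ) (α : Fin m → ι →₀ ℕ), (∀ i, (α i).degree ≤ J) ∧
        C * (d * J + J + 1) ^ s < m * (J + 1) ∧
        LinearIndependent k fun i => (α i).prod fun j e => f j ^ e := by
  set V := Submodule.span k (insert 1 (Set.range x))
  have h1V : 1 ≤ V := Submodule.one_le.2 (Submodule.subset_span (Set.mem_insert _ _))
  constructor
  · intro halg
    -- With `J = (s + 1) K` and `m = (K + 1) ^ s`, the dimension bound is at most `K (K + 1) ^ s`,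
    -- while `J ≥ K`. The factor `s + 1`, rather than `s`, keeps `J ≥ K` when `s = 0`.
    set K := C * ((d + 1) * (s + 1)) ^ s with hK
    obtain ⟨α, hα, hli⟩ := exists_linearIndependent_monomials halg hs K
    refine ⟨(s + 1) * K, (K + 1) ^ s, α, fun i => (hα i).trans (by gcongr; omega), ?_, hli⟩
    calc C * (d * ((s + 1) * K) + (s + 1) * K + 1) ^ s
        ≤ C * ((d + 1) * (s + 1) * (K + 1)) ^ s := by
          gcongr
          nlinarith [Nat.zero_le (d * s), Nat.zero_le d, Nat.zero_le s]
      _ = (K + 1) ^ s * K := by rw [mul_pow, hK]; ring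
      _ < (K + 1) ^ s * ((s + 1) * K + 1) := by
          gcongr
          nlinarith [Nat.zero_le (s * K)]
  · rintro ⟨J, m, α, hα, hlt, hli⟩
    by_contra hna
    have hex : ∃ i, Transcendental (Algebra.adjoin k (Set.range f)) (x i) := by
      by_contra! hall
      refine hna ?_
      exact isAlgebraic_of_forall_generator hx fun i => by simpa [Transcendental] using hall i
    obtain ⟨i, hi⟩ := hex
    let F : Fin m → Algebra.adjoin k (Set.range f) := fun i =>
      ⟨(α i).prod fun j e => f j ^ e, Subalgebra.prod_mem _ fun j _ =>
        Subalgebra.pow_mem _ (Algebra.subset_adjoin (Set.mem_range_self j)) _⟩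
    have hF : LinearIndependent k F :=
      LinearIndependent.of_comp (Algebra.adjoin k (Set.range f)).val.toLinearMap hli
    -- Independence over `k` inside `k[f]` and of the powers of `x i` over `k[f]` multiply along the
    -- tower.
    have hprod := linearIndependent_smul hF (linearIndependent_pow_of_transcendental hi (J + 1))
    have hmem : ∀ p : Fin m × Fin (J + 1), F p.1 • x i ^ (p.2 : ℕ) ∈ V ^ (d * J + J) := by
      rintro ⟨a, b⟩
      rw [pow_add]
      refine Submodule.mul_mem_mul (M := V ^ (d * J)) (N := V ^ J) ?_ ?_
      · have h1 : ((α a).prod fun j e => f j ^ e) ∈ V ^ (d * (α a).degree) := by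
          rw [Finsupp.degree_apply, Finset.mul_sum]
          exact prod_pow_mem_pow hf _ _
        exact pow_le_pow_right₀ h1V (by gcongr; exact hα a) h1
      · exact pow_le_pow_right₀ h1V (Nat.lt_succ_iff.1 b.2)
          (Submodule.pow_mem_pow _ (Submodule.subset_span (Set.mem_insert_of_mem _ (Set.mem_range_self i))) _)
    have hfg : (V ^ (d * J + J)).FG :=
      (Submodule.fg_span ((Set.finite_range x).insert 1)).pow _
    have : Module.Finite k ↥(V ^ (d * J + J)) := Module.Finite.iff_fg.2 hfg
    have hli' : LinearIndependent k fun p => (⟨_, hmem p⟩ : ↥(V ^ (d * J + J))) :=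
      LinearIndependent.of_comp (V ^ (d * J + J)).subtype hprod
    have hcard := hli'.fintype_card_le_finrank
    simp only [Fintype.card_prod, Fintype.card_fin] at hcard
    exact absurd (hcard.trans (hC _)) (by omega)

end Criterion

/-! ### Subalgebras of full dimension -/

section Subalgebra

variable {k : Type*} [Field k] {R : Type*} [CommRing R] [IsDomain R] [Algebra k R]
  [Algebra.FiniteType k R] {ι : Type*} [Finite ι]

/-- Transcendence degree is additive along `k ⊆ k[f] ⊆ R`; as the total is finite, equality at the
first step means degree zero at the second. -/
theorem ringKrullDim_adjoin_eq_iff_isAlgebraic (f : ι → R) :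
    ringKrullDim (Algebra.adjoin k (Set.range f)) = ringKrullDim R ↔
      Algebra.IsAlgebraic (Algebra.adjoin k (Set.range f)) R := by
  have hfg : Algebra.FiniteType k (Algebra.adjoin k (Set.range f)) :=
    (Subalgebra.fg_iff_finiteType _).1 (Subalgebra.fg_def.2 ⟨_, Set.finite_range f, rfl⟩)
  obtain ⟨s, -, -, -, h1, h2⟩ := exists_finite_mvPolynomial_ringKrullDim_eq k R
  rw [h1, ringKrullDim_eq_natCast_iff_trdeg k]
  have hadd := trdeg_add_eq k (Algebra.adjoin k (Set.range f)) (A := R)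
  rw [h2] at hadd
  rw [← trdeg_eq_zero_iff]
  constructor
  · intro h
    rw [h] at hadd
    exact Cardinal.eq_of_add_eq_add_left (hadd.trans (add_zero _).symm) (Cardinal.natCast_lt_aleph0)
  · intro h
    rwa [h, add_zero] at hadd

end Subalgebra

/-! ### Separating homogeneous components by a scaling variable -/

section Homogeneous

variable {k : Type*} [Field k] {ι : Type*} {A : Type*} [CommRing A] [Algebra k A]

theorem aeval_C_mul_X_pow_of_isHomogeneous (f : ι → A) (e : ℕ) {j : ℕ} {Q : MvPolynomial ι k}
    (hQ : Q.IsHomogeneous j) :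
    aeval (fun i => Polynomial.C (f i) * Polynomial.X ^ e) Q
      = Polynomial.C (aeval f Q) * Polynomial.X ^ (e * j) := by
  rw [Q.as_sum, map_sum, map_sum, map_sum, Finset.sum_mul]
  refine Finset.sum_congr rfl fun c hc => ?_
  have hdeg : ∑ i ∈ c.support, c i = j := by
    have := hQ (mem_support_iff.1 hc)
    rwa [Pi.one_def, ← Finsupp.degree_eq_weight_one, Finsupp.degree_apply] at this
  simp only [aeval_monomial, Finsupp.prod, mul_pow, Finset.prod_mul_distrib, ← pow_mul,
    Finset.prod_pow_eq_pow_sum, map_mul, map_prod, map_pow, ← Finset.mul_sum, hdeg]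
  rw [Polynomial.algebraMap_apply, mul_assoc]

theorem coeff_aeval_C_mul_X_pow (f : ι → A) {e : ℕ} (he : 1 ≤ e) (Q : MvPolynomial ι k) (j : ℕ) :
    (aeval (fun i => Polynomial.C (f i) * Polynomial.X ^ e) Q).coeff (e * j)
      = aeval f (homogeneousComponent j Q) := by
  conv_lhs => rw [← sum_homogeneousComponent Q, map_sum, Polynomial.finsetSum_coeff]
  simp only [aeval_C_mul_X_pow_of_isHomogeneous f e (homogeneousComponent_isHomogeneous _ Q),
    Polynomial.coeff_C_mul_X_pow, mul_right_inj' (show e ≠ 0 by omega)]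
  rw [Finset.sum_ite_eq]
  split_ifs with h
  · rfl
  · rw [homogeneousComponent_eq_zero _ _ (by simpa using h), map_zero]

theorem aeval_eq_zero_of_homogeneousComponent (f : ι → A) {Q : MvPolynomial ι k}
    (h : ∀ j, aeval f (homogeneousComponent j Q) = 0) : aeval f Q = 0 := by
  rw [← sum_homogeneousComponent Q, map_sum]
  exact Finset.sum_eq_zero fun j _ => h j

end Homogeneous

/-! ### The special fiber as a subalgebra -/

section Fiber

variable {k A : Type*} [Field k] [CommRing A] [Algebra k A] {ι : Type*} {f : ι → A} {d : ℕ}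

/-- The map `δ` plays the role of a grading, with `X`-divisibility of `δ r` bounding the order of
`r` from below. -/
theorem X_pow_dvd_of_mem_span_pow {δ : A →ₐ[k] Polynomial A}
    (hf : ∀ i, δ (f i) = Polynomial.C (f i) * Polynomial.X ^ d) {j : ℕ} {r : A}
    (hr : r ∈ Ideal.span (Set.range f) ^ j) : Polynomial.X ^ (d * j) ∣ δ r := by
  have h1 : Ideal.span (Set.range f) ≤ (Ideal.span {Polynomial.X ^ d}).comap δ := by
    rw [Ideal.span_le]
    rintro _ ⟨i, rfl⟩
    exact Ideal.mem_span_singleton.2 ⟨Polynomial.C (f i), by rw [mul_comm]; exact hf i⟩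
  have h2 := Ideal.le_comap_pow δ j (Ideal.pow_right_mono h1 j hr)
  rw [Ideal.span_singleton_pow, ← pow_mul] at h2
  exact Ideal.mem_span_singleton.1 h2

/-- A factor from `𝔪` adds one to the order `d * j` already forced by membership in `I ^ j`. -/
theorem X_pow_succ_dvd_coeff_of_mem_map {δ : A →ₐ[k] Polynomial A}
    (hf : ∀ i, δ (f i) = Polynomial.C (f i) * Polynomial.X ^ d) {𝔪 : Ideal A}
    (h𝔪 : ∀ r ∈ 𝔪, Polynomial.X ∣ δ r) {w : reesAlgebra (Ideal.span (Set.range f))}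
    (hw : w ∈ 𝔪.map (algebraMap A (reesAlgebra (Ideal.span (Set.range f))))) (j : ℕ) :
    Polynomial.X ^ (d * j + 1) ∣ δ ((w : Polynomial A).coeff j) := by
  revert j
  refine Submodule.span_induction (p := fun (w : reesAlgebra (Ideal.span (Set.range f))) _ =>
    ∀ j, Polynomial.X ^ (d * j + 1) ∣
      δ ((w : Polynomial A).coeff j)) ?_ ?_ ?_ ?_ hw
  · rintro _ ⟨r, hr, rfl⟩ j
    change _ ∣ δ ((Polynomial.C r).coeff j)
    rw [Polynomial.coeff_C]
    split_ifs with h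
    · subst h
      simpa using h𝔪 r hr
    · simp
  · simp
  · intro x y _ _ hx hy j
    change _ ∣ δ (((x : Polynomial A) + (y : Polynomial A)).coeff j)
    rw [Polynomial.coeff_add, map_add]
    exact dvd_add (hx j) (hy j)
  · intro z x _ hx j
    change _ ∣ δ (((z : Polynomial A) * (x : Polynomial A)).coeff j)
    rw [Polynomial.coeff_mul, map_sum]
    refine Finset.dvd_sum fun ab hab => ?_
    rw [map_mul, ← Finset.HasAntidiagonal.mem_antidiagonal.1 hab,
      show d * (ab.1 + ab.2) + 1 = d * ab.1 + (d * ab.2 + 1) by ring, pow_add]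
    exact mul_dvd_mul (X_pow_dvd_of_mem_span_pow hf (z.2 ab.1)) (hx ab.2)

/-- The presentation `k[T] → A[It]`, `T_i ↦ f_i t`, of the Rees algebra modulo the coefficient
ring. -/
noncomputable def reesHom (k : Type*) [Field k] [Algebra k A] (f : ι → A) :
    MvPolynomial ι k →ₐ[k] reesAlgebra (Ideal.span (Set.range f)) :=
  aeval fun i => ⟨Polynomial.monomial 1 (f i), reesAlgebra.monomial_mem.2 (by
    rw [pow_one]; exact Ideal.subset_span (Set.mem_range_self i))⟩

theorem coe_reesHom (f : ι → A) (P : MvPolynomial ι k) :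
    (reesHom k f P : Polynomial A) = aeval (fun i => Polynomial.C (f i) * Polynomial.X ^ 1) P := by
  have : ((reesAlgebra (Ideal.span (Set.range f))).val.restrictScalars k).comp (reesHom k f)
      = aeval fun i => Polynomial.C (f i) * Polynomial.X ^ 1 := by
    ext i : 1
    simp [reesHom, Polynomial.C_mul_X_eq_monomial]
  exact DFunLike.congr_fun this P

theorem coeff_reesHom (f : ι → A) (P : MvPolynomial ι k)
    (j : ℕ) : (reesHom k f P : Polynomial A).coeff j = aeval f (homogeneousComponent j P) := by
  rw [coe_reesHom]
  simpa using coeff_aeval_C_mul_X_pow f le_rfl P j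

/-- The `t ^ j` coefficient of the image of `P` is a form of degree `j` in `f`, which `δ` multiplies
by exactly `X ^ (d * j)`; membership would require order `d * j + 1`, so it vanishes. -/
theorem reesHom_mem_map_iff {δ : A →ₐ[k] Polynomial A}
    (hf : ∀ i, δ (f i) = Polynomial.C (f i) * Polynomial.X ^ d) {𝔪 : Ideal A}
    (h𝔪 : ∀ r ∈ 𝔪, Polynomial.X ∣ δ r) (hd : 1 ≤ d) (P : MvPolynomial ι k) :
    reesHom k f P ∈ 𝔪.map (algebraMap A (reesAlgebra (Ideal.span (Set.range f))))
      ↔ aeval f P = 0 := by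
  have hcomp : ∀ Q : MvPolynomial ι k, δ (aeval f Q)
      = aeval (fun i => Polynomial.C (f i) * Polynomial.X ^ d) Q := by
    intro Q
    rw [← AlgHom.comp_apply]
    congr 1
    ext i : 1
    simp [hf]
  constructor
  · intro h
    refine aeval_eq_zero_of_homogeneousComponent f fun j => ?_
    have hdvd := X_pow_succ_dvd_coeff_of_mem_map hf h𝔪 h j
    rw [coeff_reesHom, hcomp,
      aeval_C_mul_X_pow_of_isHomogeneous f d (homogeneousComponent_isHomogeneous j P)] at hdvd
    have := Polynomial.X_pow_dvd_iff.1 hdvd (d * j) (Nat.lt_succ_self _)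
    rwa [Polynomial.coeff_C_mul_X_pow, if_pos rfl] at this
  · intro h
    have : reesHom k f P = 0 := by
      refine Subtype.ext (Polynomial.ext fun j => ?_)
      -- As `d ≥ 1`, different `j` occupy different powers `X ^ (d * j)`, so a relation among the `f
      -- i` splits into its homogeneous components.
      rw [coeff_reesHom, ← coeff_aeval_C_mul_X_pow f hd, ← hcomp, h]
      simp
    rw [this]
    exact zero_mem _

/-- The Rees algebra is generated over `A` in degree one, and modulo `𝔪` every coefficient in `A` is
a constant from `k`. -/
theorem mk_reesHom_surjective (f : ι → A) {𝔪 : Ideal A}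
    (hk : ∀ r : A, ∃ c : k, r - algebraMap k A c ∈ 𝔪) :
    Function.Surjective ((Ideal.Quotient.mk (𝔪.map
      (algebraMap A (reesAlgebra (Ideal.span (Set.range f)))))).comp (reesHom k f).toRingHom) := by
  set I := Ideal.span (Set.range f)
  set 𝔞 := 𝔪.map (algebraMap A (reesAlgebra I))
  set φ := (Ideal.Quotient.mk 𝔞).comp (reesHom k f).toRingHom
  have halg : ∀ r, ∃ P, φ P = Ideal.Quotient.mk 𝔞 (algebraMap A (reesAlgebra I) r) := by
    intro r
    obtain ⟨c, hc⟩ := hk r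
    refine ⟨C c, ?_⟩
    have h1 := Ideal.mem_map_of_mem (algebraMap A (reesAlgebra I)) hc
    rw [map_sub] at h1
    rw [Ideal.Quotient.eq.2 h1]
    have h2 : reesHom k f (C c) = algebraMap A (reesAlgebra I) (algebraMap k _ c) := by
      rw [← IsScalarTower.algebraMap_apply k A (reesAlgebra I)]
      exact (reesHom k f).commutes c
    exact congrArg (Ideal.Quotient.mk 𝔞) h2
  have hgen : ∀ a (ha : a ∈ I), ∃ P, φ P = Ideal.Quotient.mk 𝔞
      ⟨Polynomial.monomial 1 a, reesAlgebra.monomial_mem.2 (by rwa [pow_one])⟩ := by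
    intro a ha
    refine Submodule.span_induction (p := fun a ha => ∃ P, φ P = Ideal.Quotient.mk 𝔞
      ⟨Polynomial.monomial 1 a, reesAlgebra.monomial_mem.2 (by rw [pow_one]; exact ha)⟩)
      ?_ ?_ ?_ ?_ ha
    · rintro _ ⟨i, rfl⟩
      exact ⟨X i, congrArg (Ideal.Quotient.mk 𝔞) (aeval_X _ i)⟩
    · refine ⟨0, ?_⟩
      rw [map_zero, ← map_zero (Ideal.Quotient.mk 𝔞)]
      congr 1
      ext1
      simp
    · rintro x y hx hy ⟨P, hP⟩ ⟨Q, hQ⟩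
      refine ⟨P + Q, ?_⟩
      rw [map_add, hP, hQ, ← map_add]
      congr 1
      ext1
      simp
    · rintro r x hx ⟨P, hP⟩
      obtain ⟨Q, hQ⟩ := halg r
      refine ⟨Q * P, ?_⟩
      rw [map_mul, hP, hQ, ← map_mul]
      congr 1
      ext1
      change Polynomial.C r * Polynomial.monomial 1 x = _
      rw [Polynomial.C_mul_monomial]
      rfl
  intro z
  obtain ⟨⟨w, hw⟩, rfl⟩ := Ideal.Quotient.mk_surjective z
  have hw' := hw
  rw [← adjoin_monomial_eq_reesAlgebra] at hw'
  refine Algebra.adjoin_induction (p := fun w _ => ∀ hw : w ∈ reesAlgebra I,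
    ∃ P, φ P = Ideal.Quotient.mk 𝔞 ⟨w, hw⟩) ?_ ?_ ?_ ?_ hw' hw
  · rintro _ ⟨a, ha, rfl⟩ _
    exact hgen a ha
  · intro r _
    exact halg r
  · intro x y hx hy hPx hPy _
    rw [adjoin_monomial_eq_reesAlgebra] at hx hy
    obtain ⟨P, hP⟩ := hPx hx
    obtain ⟨Q, hQ⟩ := hPy hy
    exact ⟨P + Q, by rw [map_add, hP, hQ, ← map_add]; rfl⟩
  · intro x y hx hy hPx hPy _
    rw [adjoin_monomial_eq_reesAlgebra] at hx hy
    obtain ⟨P, hP⟩ := hPx hx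
    obtain ⟨Q, hQ⟩ := hPy hy
    exact ⟨P * Q, by rw [map_mul, hP, hQ, ← map_mul]; rfl⟩

theorem analyticSpread_span_eq_ringKrullDim_adjoin {δ : A →ₐ[k] Polynomial A}
    (hf : ∀ i, δ (f i) = Polynomial.C (f i) * Polynomial.X ^ d) {𝔪 : Ideal A}
    (h𝔪 : ∀ r ∈ 𝔪, Polynomial.X ∣ δ r) (hk : ∀ r : A, ∃ c : k, r - algebraMap k A c ∈ 𝔪)
    (hd : 1 ≤ d) :
    analyticSpread 𝔪 (Ideal.span (Set.range f))
      = ringKrullDim (Algebra.adjoin k (Set.range f)) := by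
  have hker : RingHom.ker ((Ideal.Quotient.mk (𝔪.map
      (algebraMap A (reesAlgebra (Ideal.span (Set.range f)))))).comp (reesHom k f).toRingHom)
      = RingHom.ker (aeval f : MvPolynomial ι k →ₐ[k] A) := by
    ext P
    rw [RingHom.mem_ker, RingHom.mem_ker, RingHom.comp_apply, Ideal.Quotient.eq_zero_iff_mem]
    exact reesHom_mem_map_iff hf h𝔪 hd P
  rw [analyticSpread, ← ringKrullDim_eq_of_ringEquiv
    (RingHom.quotientKerEquivOfSurjective (mk_reesHom_surjective f hk)), hker,
    Algebra.adjoin_range_eq_range_aeval]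
  have hsurj : Function.Surjective (aeval (R := k) f).rangeRestrict.toRingHom :=
    (aeval (R := k) f).rangeRestrict_surjective
  have hker' : RingHom.ker (aeval (R := k) f).rangeRestrict.toRingHom
      = RingHom.ker (aeval f : MvPolynomial ι k →ₐ[k] A) := by
    ext P
    simp only [RingHom.mem_ker]
    exact Subtype.ext_iff
  rw [← hker']
  exact ringKrullDim_eq_of_ringEquiv (RingHom.quotientKerEquivOfSurjective hsurj)

end Fiber

/-! ### The grading of `R` and the analytic spread of ideals of forms -/

section Grading

variable {k : Type*} [Field k] {n : ℕ} {p : Ideal (MvPolynomial (Fin (n + 1)) k)}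

theorem homogeneousComponent_mem_of_isHomogeneous
    (hhom : p.IsHomogeneous (homogeneousSubmodule (Fin (n + 1)) k))
    {g : MvPolynomial (Fin (n + 1)) k} (hg : g ∈ p) (j : ℕ) : homogeneousComponent j g ∈ p := by
  have := hhom j hg
  rwa [← decomposition.decompose'_apply]

theorem aeval_mk_X (g : MvPolynomial (Fin (n + 1)) k) :
    aeval (fun i => Ideal.Quotient.mk p (X i)) g = Ideal.Quotient.mk p g := by
  have : aeval (fun i => Ideal.Quotient.mk p (X i)) = Ideal.Quotient.mkₐ k p := by
    ext i
    simp
  rw [this]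
  rfl

/-- The `k`-algebra homomorphism `R → R[u]`, `x_i ↦ x_i u`, encoding the grading of the quotient `R`
of the polynomial ring by a homogeneous ideal. -/
noncomputable def gradingHom (hhom : p.IsHomogeneous (homogeneousSubmodule (Fin (n + 1)) k)) :
    (MvPolynomial (Fin (n + 1)) k ⧸ p) →ₐ[k] Polynomial (MvPolynomial (Fin (n + 1)) k ⧸ p) :=
  Ideal.Quotient.liftₐ p
    (aeval fun i => Polynomial.C (Ideal.Quotient.mk p (X i)) * Polynomial.X ^ 1) (by
      intro g hg
      rw [← sum_homogeneousComponent g, map_sum]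
      refine Finset.sum_eq_zero fun j _ => ?_
      rw [aeval_C_mul_X_pow_of_isHomogeneous _ _ (homogeneousComponent_isHomogeneous j g),
        aeval_mk_X, Ideal.Quotient.eq_zero_iff_mem.2
          (homogeneousComponent_mem_of_isHomogeneous hhom hg j), map_zero, zero_mul])

variable (hhom : p.IsHomogeneous (homogeneousSubmodule (Fin (n + 1)) k))

theorem gradingHom_mk_of_isHomogeneous {d : ℕ} {g : MvPolynomial (Fin (n + 1)) k}
    (hg : g.IsHomogeneous d) :
    gradingHom hhom (Ideal.Quotient.mk p g)
      = Polynomial.C (Ideal.Quotient.mk p g) * Polynomial.X ^ d := by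
  have h : gradingHom hhom (Ideal.Quotient.mk p g)
      = aeval (fun i => Polynomial.C (Ideal.Quotient.mk p (X i)) * Polynomial.X ^ 1) g := rfl
  rw [h, aeval_C_mul_X_pow_of_isHomogeneous _ _ hg, aeval_mk_X, one_mul]

theorem X_dvd_gradingHom_of_mem_irrelevantIdeal {r : MvPolynomial (Fin (n + 1)) k ⧸ p}
    (hr : r ∈ irrelevantIdeal p) : Polynomial.X ∣ gradingHom hhom r := by
  have h := X_pow_dvd_of_mem_span_pow (δ := gradingHom hhom) (j := 1) (d := 1) (r := r)
    (f := fun i => Ideal.Quotient.mk p (X i))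
    (fun i => gradingHom_mk_of_isHomogeneous hhom (isHomogeneous_X k i))
    (by rw [pow_one]; exact hr)
  rwa [mul_one, pow_one] at h

theorem exists_sub_algebraMap_mem_irrelevantIdeal (r : MvPolynomial (Fin (n + 1)) k ⧸ p) :
    ∃ c : k, r - algebraMap k _ c ∈ irrelevantIdeal p := by
  obtain ⟨g, rfl⟩ := Ideal.Quotient.mk_surjective r
  induction g using MvPolynomial.induction_on with
  | C a => exact ⟨a, by simp [show (algebraMap k (MvPolynomial (Fin (n + 1)) k ⧸ p)) a
      = Ideal.Quotient.mk p (C a) from rfl]⟩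
  | add g h hg hh =>
    obtain ⟨a, ha⟩ := hg
    obtain ⟨b, hb⟩ := hh
    refine ⟨a + b, ?_⟩
    rw [map_add, map_add, add_sub_add_comm]
    exact add_mem ha hb
  | mul_X g i _ =>
    refine ⟨0, ?_⟩
    rw [map_zero, sub_zero, map_mul]
    exact Ideal.mul_mem_left _ _ (Ideal.subset_span (Set.mem_range_self i))

theorem formOfCoeffs_isHomogeneous {d : ℕ} (a : MonomialExponent n d → k) :
    (formOfCoeffs a).IsHomogeneous d :=
  IsHomogeneous.sum _ _ _ fun e _ => isHomogeneous_monomial _ ((mem_monomialExponent n d e.1).1 e.2)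

theorem analyticSpread_formIdeal_eq (hhom : p.IsHomogeneous (homogeneousSubmodule (Fin (n + 1)) k))
    {d m : ℕ} (hd : 1 ≤ d) (v : Fin m × MonomialExponent n d → k) :
    analyticSpread (irrelevantIdeal p) (formIdeal p v)
      = ringKrullDim (Algebra.adjoin k (Set.range (formClasses p v))) :=
  analyticSpread_span_eq_ringKrullDim_adjoin
    (fun i => gradingHom_mk_of_isHomogeneous hhom (formOfCoeffs_isHomogeneous fun e => v (i, e)))
    (fun _ => X_dvd_gradingHom_of_mem_irrelevantIdeal hhom)
    exists_sub_algebraMap_mem_irrelevantIdeal hd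

end Grading

/-! ### Linear independence through determinants -/

section Rank

variable {k E : Type*} [Field k] [AddCommGroup E] [Module k E]

/-- Arbitrary linear forms replace coordinates, so `E` may be infinite-dimensional. For independent
`w`, the coordinates of a left inverse of `k ^ m → E` give the identity matrix. -/
theorem linearIndependent_iff_exists_dual_det_ne_zero {m : ℕ} (w : Fin m → E) :
    LinearIndependent k w ↔ ∃ φ : Fin m → Module.Dual k E,
      (Matrix.of fun a b => φ a (w b)).det ≠ 0 := by
  constructor
  · intro h
    obtain ⟨g, hg⟩ := LinearMap.exists_leftInverse_of_injective (Fintype.linearCombination k w)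
      (LinearMap.ker_eq_bot.2 (h.fintypeLinearCombination_injective))
    refine ⟨fun a => LinearMap.proj a ∘ₗ g, ?_⟩
    have hgw : ∀ b, g (w b) = Pi.single b 1 := by
      intro b
      have := LinearMap.congr_fun hg (Pi.single b 1)
      simpa using this
    have : (Matrix.of fun a b => (LinearMap.proj a ∘ₗ g : Module.Dual k E) (w b))
        = (1 : Matrix (Fin m) (Fin m) k) := by
      ext a b
      simp [hgw, Matrix.one_apply, Pi.single_apply]
    rw [this, Matrix.det_one]
    exact one_ne_zero
  · rintro ⟨φ, hφ⟩
    rw [Fintype.linearIndependent_iff]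
    intro c hc
    refine fun i => congrFun (Matrix.eq_zero_of_mulVec_eq_zero hφ (v := c) ?_) i
    ext a
    have := congrArg (φ a) hc
    simpa [Matrix.mulVec, dotProduct, mul_comm] using this

theorem isHomogeneous_det {σ : Type*} {m : ℕ} {Q : Matrix (Fin m) (Fin m) (MvPolynomial σ k)}
    {e : Fin m → ℕ} (hQ : ∀ a b, (Q a b).IsHomogeneous (e b)) :
    Q.det.IsHomogeneous (∑ b, e b) := by
  rw [Matrix.det_apply]
  refine IsHomogeneous.sum _ _ _ fun τ _ => ?_
  have h := IsHomogeneous.prod Finset.univ (fun b => Q (τ b) b) e fun b _ => hQ _ _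
  rcases Int.units_eq_one_or (Equiv.Perm.sign τ) with h' | h'
  · simpa [h'] using h
  · simpa [h'] using h.neg

end Rank

/-! ### Polynomial dependence on the coefficients -/

section Polynomial

variable {k : Type*} [Field k] {R : Type*} [CommRing R] [Algebra k R] {σ : Type*}

/-- The map `h` from `k^σ` to a `k`-vector space is homogeneous polynomial of degree `j`: so is its
composition with each linear form. -/
def IsHomogeneousMap (j : ℕ) (h : (σ → k) → R) : Prop :=
  ∀ φ : Module.Dual k R, ∃ Q : MvPolynomial σ k, Q.IsHomogeneous j ∧ ∀ v, φ (h v) = eval v Q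

theorem IsHomogeneousMap.const (r : R) : IsHomogeneousMap 0 fun _ : σ → k => r :=
  fun φ => ⟨C (φ r), isHomogeneous_C _ _, fun v => by simp⟩

theorem IsHomogeneousMap.linear_mul {j : ℕ} {h : (σ → k) → R} (hh : IsHomogeneousMap j h)
    {κ : Type*} [Fintype κ] (r : κ → R) (s : κ → σ) :
    IsHomogeneousMap (j + 1) fun v => (∑ e, v (s e) • r e) * h v := by
  intro φ
  -- Multiplication by `r e` is absorbed into the linear form, leaving only the scalar `v (s e)` as
  -- a new factor.
  choose Q hQ hQv using fun e => hh (φ ∘ₗ LinearMap.mulLeft k (r e))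
  refine ⟨∑ e, Q e * X (s e), IsHomogeneous.sum _ _ _ fun e _ => (hQ e).mul (isHomogeneous_X _ _),
    fun v => ?_⟩
  simp only [Finset.sum_mul, map_sum, map_mul, eval_X, smul_mul_assoc, map_smul, smul_eq_mul]
  refine Finset.sum_congr rfl fun e _ => ?_
  rw [← hQv, mul_comm]
  rfl

theorem IsHomogeneousMap.prod_linear_pow {κ ι : Type*} [Fintype κ] (r : κ → R) (s : ι → κ → σ)
    (c : ι → ℕ) (t : Finset ι) :
    IsHomogeneousMap (∑ i ∈ t, c i) fun v : σ → k => ∏ i ∈ t, (∑ e, v (s i e) • r e) ^ c i := by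
  classical
  induction t using Finset.induction_on with
  | empty => simpa using IsHomogeneousMap.const (1 : R)
  | insert a t ha ih =>
    have hpow : ∀ b : ℕ, IsHomogeneousMap (∑ i ∈ t, c i + b) fun v : σ → k =>
        (∑ e, v (s a e) • r e) ^ b * ∏ i ∈ t, (∑ e, v (s i e) • r e) ^ c i := by
      intro b
      induction b with
      | zero => simpa using ih
      | succ b ihb => simpa only [pow_succ', mul_assoc, add_assoc] using ihb.linear_mul r (s a)
    simpa only [Finset.sum_insert ha, Finset.prod_insert ha, add_comm] using hpow (c a)

end Polynomial

/-! ### Openness and non-emptiness of the locus -/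

section Locus

variable {k : Type*} [Field k] {n d : ℕ} {p : Ideal (MvPolynomial (Fin (n + 1)) k)}

theorem adjoin_range_mk_X :
    Algebra.adjoin k (Set.range fun i => Ideal.Quotient.mk p (X i)) = ⊤ := by
  rw [Algebra.adjoin_range_eq_range_aeval, AlgHom.range_eq_top]
  intro r
  obtain ⟨g, rfl⟩ := Ideal.Quotient.mk_surjective r
  exact ⟨g, aeval_mk_X g⟩

theorem formClasses_eq_sum_smul {m : ℕ} (v : Fin m × MonomialExponent n d → k) (i : Fin m) :
    formClasses p v i = ∑ e, v (i, e) • Ideal.Quotient.mk p (monomial e.1 1) := by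
  rw [formClasses, formOfCoeffs, map_sum]
  refine Finset.sum_congr rfl fun e _ => ?_
  rw [← mul_one (v (i, e)), ← smul_eq_mul, ← smul_monomial, smul_eq_mul, mul_one]
  rfl

theorem mk_monomial_mem_pow (e : Fin (n + 1) →₀ ℕ) :
    Ideal.Quotient.mk p (monomial e 1) ∈
      Submodule.span k (insert 1 (Set.range fun i => Ideal.Quotient.mk p (X i))) ^ e.degree := by
  have h := prod_pow_mem_pow (V := Submodule.span k (insert 1 (Set.range fun i =>
    Ideal.Quotient.mk p (X i)))) (d := 1) (f := fun i => Ideal.Quotient.mk p (X i))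
    (fun i => by rw [pow_one]
                 exact Submodule.subset_span (Set.mem_insert_of_mem _ (Set.mem_range_self i)))
    e e.support
  simp only [one_mul] at h
  rw [monomial_eq, map_one, one_mul, Finsupp.prod, map_prod, Finsupp.degree_apply]
  simpa only [map_pow] using h

theorem formClasses_mem_pow {m : ℕ} (v : Fin m × MonomialExponent n d → k) (i : Fin m) :
    formClasses p v i ∈
      Submodule.span k (insert 1 (Set.range fun i => Ideal.Quotient.mk p (X i))) ^ d := by
  rw [formClasses_eq_sum_smul]
  refine Submodule.sum_mem _ fun e _ => Submodule.smul_mem _ _ ?_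
  have := mk_monomial_mem_pow (p := p) e.1
  rwa [(mem_monomialExponent n d e.1).1 e.2] at this

theorem isHomogeneousMap_prod_formClasses {m : ℕ} (c : Fin m →₀ ℕ) :
    IsHomogeneousMap c.degree fun v : Fin m × MonomialExponent n d → k =>
      c.prod fun i e => formClasses p v i ^ e := by
  simp only [formClasses_eq_sum_smul, Finsupp.prod, Finsupp.degree_apply]
  exact IsHomogeneousMap.prod_linear_pow _ (fun i e => (i, e)) c c.support

theorem mem_noetherNormalizationLocus_iff_isAlgebraic [p.IsPrime]
    (hhom : p.IsHomogeneous (homogeneousSubmodule (Fin (n + 1)) k)) (hd : 1 ≤ d) {m : ℕ}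
    (v : Fin m × MonomialExponent n d → k) (hv : v ≠ 0) :
    Projectivization.mk k v hv ∈ noetherNormalizationLocus p d m ↔
      Algebra.IsAlgebraic (Algebra.adjoin k (Set.range (formClasses p v)))
        (MvPolynomial (Fin (n + 1)) k ⧸ p) := by
  rw [mk_mem_noetherNormalizationLocus, analyticSpread_formIdeal_eq hhom hd,
    ringKrullDim_adjoin_eq_iff_isAlgebraic]

theorem isZariskiOpen_noetherNormalizationLocus [p.IsPrime]
    (hhom : p.IsHomogeneous (homogeneousSubmodule (Fin (n + 1)) k)) (hd : 1 ≤ d) (m : ℕ) :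
    IsZariskiOpen (noetherNormalizationLocus p d m) := by
  obtain ⟨s, g, -, hg, -, hs⟩ :=
    exists_finite_mvPolynomial_ringKrullDim_eq k (MvPolynomial (Fin (n + 1)) k ⧸ p)
  -- Both `s` and `C` are fixed before the point `v`, so a single family of polynomials tests all
  -- points.
  obtain ⟨C, hC⟩ := exists_finrank_pow_le g hg (Submodule.fg_span (R := k)
    ((Set.finite_range fun i => Ideal.Quotient.mk p (X i)).insert 1))
  refine ⟨{F | (∃ e, F.IsHomogeneous e) ∧ ∃ (J l : ℕ) (α : Fin l → Fin m →₀ ℕ),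
    (∀ i, (α i).degree ≤ J) ∧ C * (d * J + J + 1) ^ s < l * (J + 1) ∧
    ∃ φ : Fin l → Module.Dual k (MvPolynomial (Fin (n + 1)) k ⧸ p), ∀ v, eval v F =
      (Matrix.of fun a b => φ a ((α b).prod fun i e => formClasses p v i ^ e)).det},
    fun F hF => hF.1, fun v hv => ?_⟩
  rw [Set.mem_compl_iff, mem_noetherNormalizationLocus_iff_isAlgebraic hhom hd,
    isAlgebraic_iff_exists_linearIndependent_monomials adjoin_range_mk_X
      (formClasses_mem_pow v) hs hC]
  constructor
  · rintro h F ⟨-, J, l, α, hα, hlt, φ, hφ⟩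
    by_contra hF
    refine h ⟨J, l, α, hα, hlt, (linearIndependent_iff_exists_dual_det_ne_zero _).2 ⟨φ, ?_⟩⟩
    rwa [← hφ]
  · rintro h ⟨J, l, α, hα, hlt, hli⟩
    obtain ⟨φ, hφ⟩ := (linearIndependent_iff_exists_dual_det_ne_zero _).1 hli
    choose Q hQ hQv using fun a b => isHomogeneousMap_prod_formClasses (p := p) (d := d) (α b) (φ a)
    have hdet : ∀ v, eval v (Matrix.of Q).det =
        (Matrix.of fun a b => φ a ((α b).prod fun i e => formClasses p v i ^ e)).det := by
      intro v
      rw [RingHom.map_det]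
      congr 1
      ext a b
      exact (hQv a b v).symm
    exact hφ ((hdet v).symm.trans
      (h _ ⟨⟨_, isHomogeneous_det hQ⟩, J, l, α, hα, hlt, φ, hdet⟩))

/-- The coefficients of the forms `x_0^d, …, x_n^d`. -/
noncomputable def powerCoeffs (k : Type*) [Field k] (n d : ℕ) :
    Fin (n + 1) × MonomialExponent n d → k := by
  classical
  exact fun ie => if ie.2.1 = Finsupp.single ie.1 d then 1 else 0

theorem single_mem_monomialExponent (i : Fin (n + 1)) :
    Finsupp.single i d ∈ (Finset.univ : Finset (Fin (n + 1))).finsuppAntidiag d := by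
  rw [mem_monomialExponent, Finsupp.degree_single]

theorem powerCoeffs_ne_zero : powerCoeffs k n d ≠ 0 := by
  intro h
  simpa [powerCoeffs] using congrFun h (0, ⟨_, single_mem_monomialExponent 0⟩)

theorem formClasses_powerCoeffs (i : Fin (n + 1)) :
    formClasses p (powerCoeffs k n d) i = Ideal.Quotient.mk p (X i) ^ d := by
  rw [formClasses, formOfCoeffs, Finset.sum_eq_single ⟨_, single_mem_monomialExponent i⟩]
  · simp [powerCoeffs, X_pow_eq_monomial, ← map_pow]
  · intro e _ he
    have : e.1 ≠ Finsupp.single i d := fun h => he (Subtype.ext h)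
    simp [powerCoeffs, this]
  · simp

/-- The point of the forms `x_i ^ d` works: each `x_i` is algebraic over the subalgebra containing
its `d`-th power. -/
theorem noetherNormalizationLocus_nonempty [p.IsPrime]
    (hhom : p.IsHomogeneous (homogeneousSubmodule (Fin (n + 1)) k)) (hd : 1 ≤ d) :
    (noetherNormalizationLocus p d (n + 1)).Nonempty := by
  refine ⟨Projectivization.mk k (powerCoeffs k n d) powerCoeffs_ne_zero,
    (mem_noetherNormalizationLocus_iff_isAlgebraic hhom hd _ _).2
      (isAlgebraic_of_forall_generator adjoin_range_mk_X fun i => ?_)⟩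
  refine IsAlgebraic.of_pow (n := d) (by omega) ?_
  rw [← formClasses_powerCoeffs]
  exact isAlgebraic_algebraMap (⟨_, Algebra.subset_adjoin (Set.mem_range_self i)⟩ :
    Algebra.adjoin k (Set.range (formClasses p (powerCoeffs k n d))))

theorem ringKrullDim_quotient_le_succ :
    ringKrullDim (MvPolynomial (Fin (n + 1)) k ⧸ p) ≤ ((n + 1 : ℕ) : WithBot ℕ∞) := by
  refine (ringKrullDim_quotient_le p).trans ?_
  simp

end Locus

theorem theorem2 {k : Type*} [Field k] [Infinite k] (n d : ℕ) (hd : 1 ≤ d)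
    (p : Ideal (MvPolynomial (Fin (n + 1)) k)) (hprime : p.IsPrime)
    (hhom : p.IsHomogeneous (MvPolynomial.homogeneousSubmodule (Fin (n + 1)) k)) :
    (noetherNormalizationLocus p d (n + 1)).Nonempty ∧
    IsZariskiOpen (noetherNormalizationLocus p d (n + 1)) ∧
    ∀ (v : Fin (n + 1) × MonomialExponent n d → k) (hv : v ≠ 0),
      Projectivization.mk k v hv ∈ noetherNormalizationLocus p d (n + 1) ↔
        HasMaximumAnalyticSpread (irrelevantIdeal p) (formClasses p v) := by
  refine ⟨noetherNormalizationLocus_nonempty hhom hd,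
    isZariskiOpen_noetherNormalizationLocus hhom hd _, fun v hv => ?_⟩
  rw [mk_mem_noetherNormalizationLocus, HasMaximumAnalyticSpread,
    min_eq_left ringKrullDim_quotient_le_succ]
  rfl
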